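/- Let $d\ge 0$ and $N\ge 1$ be integers, and let $H$ be an $N$-band Bloch Hamiltonian in $d$ dimensions, i.e. an $N\times N$-matrix-valued function $H(\mathbf z)$ of $\mathbf z=(z_1,\dots,z_d)$ whose entries are analytic on $(\mathbb C\setminus\{0\})^d$ (for example Laurent polynomials, as for finite-range hopping). Let $$\Sigma_{\mathrm{PBC}}=\{E\in\mathbb C:\ \det(E-H(\mathbf z))=0\text{ for some }\mathbf z\text{ with }|z_1|=\dots=|z_d|=1\}.$$ For $E\in\mathbb C$ let the amoeba be $$\mathcal A_E=\{\boldsymbol\mu\in\mathbb R^d:\ \det(E-H(e^{\boldsymbol\mu+i\boldsymbol\theta}))=0\text{ for some }\boldsymbol\theta\in\mathbb R^d\},\qquad e^{\boldsymbol\mu+i\boldsymbol\theta}=(e^{\mu_1+i\theta_1},\dots,e^{\mu_d+i\theta_d}),$$ let the Ronkin function be $$R_E(\boldsymbol\mu)=\frac1{(2\pi)^d}\int_{[0,2\pi]^d}\log\bigl|\det(E-H(e^{\boldsymbol\mu+i\boldsymbol\theta}))\bigr|\,\mathrm d^d\boldsymbol\theta ,$$ and call a connected component of $\mathbb R^d\setminus\mathcal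 A_E$ on which $R_E$ is constant a central hole of $\mathcal A_E$. Then $\max_{E'\in\Sigma_{\mathrm{PBC}}}\mathrm{Im}\,E'$ exists, and for every $E\in\mathbb C$ with $\mathrm{Im}\,E>\max_{E'\in\Sigma_{\mathrm{PBC}}}\mathrm{Im}\,E'$: 1. the point $\boldsymbol\mu=0$ lies in a central hole of $\mathcal A_E$; 2. $R_E$ is differentiable at $\boldsymbol\mu=0$ with $\nabla R_E(0)=0$; 3. for every $j\in\{1,\dots,d\}$ and all fixed values of the other angles, the function $\theta_j\mapsto\det(E-H(e^{i\boldsymbol\theta}))$ does not vanish on $[0,2\pi]$, and its winding number around $0$ as $\theta_j$ goes from $0$ to $2\pi$ is $0$. -/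

import Mathlib

noncomputable section

/-- The point `e^{μ + iθ} = (e^{μ₁ + iθ₁}, …, e^{μ_d + iθ_d})` of `(ℂ \ {0})^d`. -/
def expPoint {d : ℕ} (μ θ : Fin d → ℝ) : Fin d → ℂ :=
  fun i => Complex.exp ((μ i : ℂ) + (θ i : ℂ) * Complex.I)

/-- The characteristic function `det (E - H(z))` of a matrix-valued symbol `H`. -/
def charDet {d N : ℕ} (H : (Fin d → ℂ) → Matrix (Fin N) (Fin N) ℂ) (E : ℂ)
    (z : Fin d → ℂ) : ℂ :=
  (E • (1 : Matrix (Fin N) (Fin N) ℂ) - H z).det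

/-- `H` is an `N`-band Bloch Hamiltonian on a `d`-dimensional lattice: every matrix entry is an
analytic function of `z` on `{z ∈ ℂ^d | z_i ≠ 0 for all i}`. (For finite-range hopping the entries
are Laurent polynomials in the `z_i`.) -/
def IsBlochHamiltonian {d N : ℕ} (H : (Fin d → ℂ) → Matrix (Fin N) (Fin N) ℂ) : Prop :=
  ∀ a b, AnalyticOnNhd ℂ (fun z => H z a b) {z | ∀ i, z i ≠ 0}

/-- The spectrum under periodic boundary conditions: the energies `E` that are eigenvalues of
`H(z)` for some `z` in the Brillouin zone `|z₁| = … = |z_d| = 1`. -/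
def pbcSpectrum {d N : ℕ} (H : (Fin d → ℂ) → Matrix (Fin N) (Fin N) ℂ) : Set ℂ :=
  {E | ∃ z : Fin d → ℂ, (∀ i, ‖z i‖ = 1) ∧ charDet H E z = 0}

/-- The amoeba `A_E`: the set of all `log |z|` with `det (E - H(z)) = 0`, where all `z_i ≠ 0`. -/
def amoeba {d N : ℕ} (H : (Fin d → ℂ) → Matrix (Fin N) (Fin N) ℂ) (E : ℂ) :
    Set (Fin d → ℝ) :=
  {μ | ∃ θ : Fin d → ℝ, charDet H E (expPoint μ θ) = 0}

/-- The Ronkin function: the average over `θ ∈ [0, 2π]^d` of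
`Re (log (det (E - H(e^{μ + iθ})))) = log |det (E - H(e^{μ + iθ}))|`. -/
def ronkin {d N : ℕ} (H : (Fin d → ℂ) → Matrix (Fin N) (Fin N) ℂ) (E : ℂ)
    (μ : Fin d → ℝ) : ℝ :=
  ((2 * Real.pi) ^ d)⁻¹ *
    ∫ θ in Set.Icc (0 : Fin d → ℝ) (fun _ => 2 * Real.pi),
      Real.log ‖charDet H E (expPoint μ θ)‖

/-- `U` is an amoeba central hole: a connected component of the complement of the amoeba on which
the Ronkin function is constant. -/
def IsCentralHole {d N : ℕ} (H : (Fin d → ℂ) → Matrix (Fin N) (Fin N) ℂ) (E : ℂ)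
    (U : Set (Fin d → ℝ)) : Prop :=
  (∃ μ ∈ (amoeba H E)ᶜ, U = connectedComponentIn (amoeba H E)ᶜ μ) ∧
    ∀ μ₁ ∈ U, ∀ μ₂ ∈ U, ronkin H E μ₁ = ronkin H E μ₂

/-- On `[0, 2π]` the curve `γ` never vanishes, has a continuous phase angle `φ`, and that phase
angle increases by `2π n` in total: `γ` winds `n` times around `0`. -/
def HasWindingNumber (γ : ℝ → ℂ) (n : ℤ) : Prop :=
  ∃ φ : ℝ → ℝ, ContinuousOn φ (Set.Icc 0 (2 * Real.pi)) ∧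
    (∀ t ∈ Set.Icc 0 (2 * Real.pi),
      γ t ≠ 0 ∧ γ t = (‖γ t‖ : ℂ) * Complex.exp ((φ t : ℂ) * Complex.I)) ∧
    φ (2 * Real.pi) - φ 0 = 2 * Real.pi * n

end

/-!
The change of `log det (E - H)` along a Brillouin-zone loop lies in `2πiℤ` and depends continuously
on `E` and `H` as long as `E` stays off the PBC spectrum, so it survives deformation. A set of
energies that is connected, unbounded and disjoint from the spectrum lets us move `E` to where
`|E|` exceeds every `‖H(z)‖`; there the hopping can be switched off through `b • H` with `b → 0`,
which makes the loop constant. Hence all windings vanish at `μ = 0`, and likewise throughout the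
component of the complement of the amoeba containing `0`.

As `det (E - H(e^w))` is holomorphic in `w = μ + iθ`, the Cauchy–Riemann equations turn the
`μ_j`-derivative of `log |det|` into the `θ_j`-derivative of the phase of `det`. Thus `∂_j R_E` is
the average over the remaining angles of the winding in `θ_j`, and `R_E` is constant on that
component.
-/

open Complex MeasureTheory Set

section Loops

/-- The change of a continuous logarithm of `γ` over `[0, 2π]`. For a `C¹` loop in `ℂ \ {0}` it is
`2πi` times the winding number of `γ` around `0`. -/
noncomputable def logIncrement (γ : ℝ → ℂ) : ℂ :=
  ∫ t in (0 : ℝ)..2 * Real.pi, logDeriv γ t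

variable {γ : ℝ → ℂ}

theorem continuous_logDeriv (hγ : ContDiff ℝ 1 γ) (h0 : ∀ t, γ t ≠ 0) :
    Continuous (logDeriv γ) :=
  hγ.continuous_deriv_one.div hγ.continuous h0

theorem eq_mul_exp_integral_logDeriv (hγ : ContDiff ℝ 1 γ) (h0 : ∀ t, γ t ≠ 0) (a t : ℝ) :
    γ t = γ a * exp (∫ s in a..t, logDeriv γ s) := by
  have hderiv (t : ℝ) : HasDerivAt (fun t => γ t * exp (-∫ s in a..t, logDeriv γ s)) 0 t := by
    have hintegral : HasDerivAt (fun t => ∫ s in a..t, logDeriv γ s) (logDeriv γ t) t :=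
      ((continuous_logDeriv hγ h0).integral_hasStrictDerivAt a t).hasDerivAt
    refine (((hγ.differentiable one_ne_zero t).hasDerivAt).fun_mul
      hintegral.fun_neg.cexp).congr_deriv ?_
    rw [logDeriv_apply]
    have := h0 t
    field_simp
    ring
  have hconst := is_const_of_deriv_eq_zero (fun t => (hderiv t).differentiableAt)
    (fun t => (hderiv t).deriv) t a
  simp only [intervalIntegral.integral_same, neg_zero, exp_zero, mul_one] at hconst
  rw [← hconst, mul_assoc, ← exp_add, neg_add_cancel, exp_zero, mul_one]

theorem logIncrement_mem_zmultiples (hγ : ContDiff ℝ 1 γ) (h0 : ∀ t, γ t ≠ 0)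
    (hclosed : γ (2 * Real.pi) = γ 0) :
    logIncrement γ ∈ AddSubgroup.zmultiples (2 * Real.pi * I) := by
  have h := eq_mul_exp_integral_logDeriv hγ h0 0 (2 * Real.pi)
  rw [hclosed, eq_comm, mul_eq_left₀ (h0 0), exp_eq_one_iff] at h
  obtain ⟨n, hn⟩ := h
  exact ⟨n, by simpa only [zsmul_eq_mul, logIncrement] using hn.symm⟩

theorem hasWindingNumber_of_logIncrement_eq (hγ : ContDiff ℝ 1 γ) (h0 : ∀ t, γ t ≠ 0) {n : ℤ}
    (hn : logIncrement γ = n * (2 * Real.pi * I)) : HasWindingNumber γ n := by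
  have hcont : Continuous fun t => ∫ s in (0 : ℝ)..t, logDeriv γ s :=
    intervalIntegral.continuous_primitive
      (fun a b => (continuous_logDeriv hγ h0).intervalIntegrable a b) 0
  refine ⟨fun t => (γ 0).arg + (∫ s in (0 : ℝ)..t, logDeriv γ s).im, by fun_prop,
    fun t _ => ⟨h0 t, ?_⟩, ?_⟩
  · rw [eq_mul_exp_integral_logDeriv hγ h0 0 t, norm_mul, norm_exp]
    nth_rw 1 [← norm_mul_exp_arg_mul_I (γ 0), ← re_add_im (∫ s in (0 : ℝ)..t, logDeriv γ s)]
    push_cast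
    rw [add_mul, exp_add, exp_add]
    ring
  · rw [logIncrement] at hn
    simp only [hn, intervalIntegral.integral_same]
    simp [mul_comm]

theorem logIncrement_eq_of_isPreconnected {X : Type*} [TopologicalSpace X] {γ : X → ℝ → ℂ}
    {S : Set X} (hS : IsPreconnected S) (hγ : ∀ x ∈ S, ContDiff ℝ 1 (γ x))
    (hlog : ContinuousOn (fun q : X × ℝ => logDeriv (γ q.1) q.2) (S ×ˢ univ))
    (h0 : ∀ x ∈ S, ∀ t, γ x t ≠ 0) (hclosed : ∀ x ∈ S, γ x (2 * Real.pi) = γ x 0)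
    {x y : X} (hx : x ∈ S) (hy : y ∈ S) : logIncrement (γ x) = logIncrement (γ y) := by
  have hcont : ContinuousOn (fun x => logIncrement (γ x)) S :=
    continuousOn_iff_continuous_domRestrict.2 <|
      intervalIntegral.continuous_parametric_intervalIntegral_of_continuous'
        (f := fun (x : S) t => logDeriv (γ x) t)
        (hlog.comp_continuous (f := fun q : S × ℝ => ((q.1 : X), q.2)) (by fun_prop)
          fun q => ⟨q.1.2, trivial⟩) _ _
  exact hS.constant_of_mapsTo (T := AddSubgroup.zmultiples (2 * Real.pi * I))
    ⟨NormedSpace.discreteTopology_zmultiples _⟩ hcont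
    (fun x hx => logIncrement_mem_zmultiples (hγ x hx) (h0 x hx) (hclosed x hx)) hx hy

end Loops

section Families

variable {ι V : Type*} [DecidableEq ι] [NormedAddCommGroup V] [NormedSpace ℝ V]
  {F : V × (ι → ℝ) → ℂ}

theorem hasDerivAt_comp_update [Finite ι] {v : V} {θ : ι → ℝ} {j : ι} {t : ℝ}
    (hF : DifferentiableAt ℝ F (v, Function.update θ j t)) :
    HasDerivAt (fun s => F (v, Function.update θ j s))
      (fderiv ℝ F (v, Function.update θ j t) (0, Pi.single j 1)) t :=
  have := Fintype.ofFinite ι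
  hF.hasFDerivAt.comp_hasDerivAt t ((hasDerivAt_const t v).prodMk (hasDerivAt_update θ j t))

theorem logIncrement_update_eq_of_isPreconnected [Fintype ι] (hF : ContDiff ℝ 1 F) (θ : ι → ℝ)
    (j : ι) {S : Set V} (hS : IsPreconnected S)
    (h0 : ∀ v ∈ S, ∀ t, F (v, Function.update θ j t) ≠ 0)
    (hclosed : ∀ v ∈ S,
      F (v, Function.update θ j (2 * Real.pi)) = F (v, Function.update θ j 0))
    {v w : V} (hv : v ∈ S) (hw : w ∈ S) :
    logIncrement (fun t => F (v, Function.update θ j t)) =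
      logIncrement (fun t => F (w, Function.update θ j t)) := by
  have hupdate : Continuous fun q : V × ℝ => (q.1, Function.update θ j q.2) := by fun_prop
  refine logIncrement_eq_of_isPreconnected hS
    (fun v _ => hF.comp (contDiff_const.prodMk (contDiff_update 1 θ j))) ?_ h0 hclosed hv hw
  have hderiv : ∀ q : V × ℝ, deriv (fun t => F (q.1, Function.update θ j t)) q.2 =
      fderiv ℝ F (q.1, Function.update θ j q.2) (0, Pi.single j 1) := fun q =>
    (hasDerivAt_comp_update (hF.differentiable one_ne_zero _)).deriv
  refine ContinuousOn.congr ?_ fun q _ =>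
    congrArg (· / F (q.1, Function.update θ j q.2)) (hderiv q)
  exact (((hF.continuous_fderiv one_ne_zero).comp hupdate).clm_apply
    continuous_const).continuousOn.div (hF.continuous.comp hupdate).continuousOn
    fun q hq => h0 q.1 hq.1 q.2

end Families

section ParametricIntegral

variable {V W E : Type*} [NormedAddCommGroup V] [NormedSpace ℝ V] [ProperSpace V]
  [NormedAddCommGroup W] [NormedSpace ℝ W] [MeasurableSpace W] [BorelSpace W]
  [NormedAddCommGroup E] [NormedSpace ℝ E]

theorem hasFDerivAt_setIntegral_of_contDiffOn {F : V × W → E} {Ω : Set V} (hΩ : IsOpen Ω)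
    (hF : ContDiffOn ℝ 1 F (Ω ×ˢ univ)) {K : Set W} (hK : IsCompact K) (ν : Measure W)
    [IsFiniteMeasureOnCompacts ν] {x : V} (hx : x ∈ Ω) :
    HasFDerivAt (fun x => ∫ y in K, F (x, y) ∂ν)
      (∫ y in K, (fderiv ℝ F (x, y)).comp (ContinuousLinearMap.inl ℝ V W) ∂ν) x := by
  have hopen : IsOpen (Ω ×ˢ (univ : Set W)) := hΩ.prod isOpen_univ
  have hderiv : ContinuousOn (fun q => (fderiv ℝ F q).comp (ContinuousLinearMap.inl ℝ V W))
      (Ω ×ˢ univ) :=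
    (hF.continuousOn_fderiv_of_isOpen hopen le_rfl).clm_comp continuousOn_const
  have hslice : ∀ {x}, x ∈ Ω → MapsTo (Prod.mk x) K (Ω ×ˢ univ) := fun hx y _ => ⟨hx, trivial⟩
  obtain ⟨ε, hε, hball⟩ := Metric.nhds_basis_closedBall.mem_iff.1 (hΩ.mem_nhds hx)
  obtain ⟨C, hC⟩ := ((isCompact_closedBall x ε).prod hK).exists_bound_of_continuousOn
    (hderiv.mono (prod_mono hball (subset_univ _)))
  have hFslice : ∀ x ∈ Ω, ContinuousOn (fun y => F (x, y)) K := fun x hx =>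
    hF.continuousOn.comp (by fun_prop) (hslice hx)
  refine hasFDerivAt_integral_of_dominated_of_fderiv_le (bound := fun _ => C)
    (F' := fun x y => (fderiv ℝ F (x, y)).comp (ContinuousLinearMap.inl ℝ V W))
    (Metric.closedBall_mem_nhds x hε) ?_ ((hFslice x hx).integrableOn_compact hK)
    ((hderiv.comp (by fun_prop) (hslice hx)).integrableOn_compact hK).aestronglyMeasurable
    ?_ (continuousOn_const.integrableOn_compact hK) ?_
  · filter_upwards [hΩ.mem_nhds hx] with z hz
    exact ((hFslice z hz).integrableOn_compact hK).aestronglyMeasurable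
  · exact (ae_restrict_iff' hK.measurableSet).2 (.of_forall fun y hy z hz => hC (z, y) ⟨hz, hy⟩)
  · refine .of_forall fun y z hz => HasFDerivAt.comp (f := fun z => (z, y)) z ?_
      (hasFDerivAt_prodMk_left z y)
    exact ((hF.differentiableOn one_ne_zero).differentiableAt
      (hopen.mem_nhds ⟨hball hz, trivial⟩)).hasFDerivAt

end ParametricIntegral

theorem setIntegral_Icc_eq_zero_of_setIntegral_update {d : ℕ} {E : Type*} [NormedAddCommGroup E]
    [NormedSpace ℝ E] {f : (Fin d → ℝ) → E} {a b : Fin d → ℝ} (hf : IntegrableOn f (Icc a b))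
    (j : Fin d) (h : ∀ x, ∫ t in Icc (a j) (b j), f (Function.update x j t) = 0) :
    ∫ x in Icc a b, f x = 0 := by
  obtain _ | n := d
  · exact j.elim0
  have hpi : (volume : Measure (Fin (n + 1) → ℝ)).restrict (Icc a b) =
      Measure.pi fun i => volume.restrict (Icc (a i) (b i)) := by
    rw [← pi_univ_Icc, volume_pi, Measure.restrict_pi_pi]
  have hinsert := (measurePreserving_piFinSuccAbove
    (fun i => (volume : Measure ℝ).restrict (Icc (a i) (b i))) j).symm
  rw [IntegrableOn, hpi] at hf
  rw [hpi, ← hinsert.integral_comp (MeasurableEquiv.measurableEmbedding _)]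
  refine (integral_prod_symm _
    ((hinsert.integrable_comp_emb (MeasurableEquiv.measurableEmbedding _)).2 hf)).trans
      (integral_eq_zero_of_ae (.of_forall fun y => ?_))
  simpa [MeasurableEquiv.piFinSuccAbove, Fin.insertNthEquiv] using h (j.insertNth 0 y)

section LogNorm

variable {V : Type*} [NormedAddCommGroup V] [NormedSpace ℝ V] {f : V → ℂ}

theorem fderiv_log_norm_apply {x : V} (hf : DifferentiableAt ℝ f x) (h0 : f x ≠ 0) (v : V) :
    fderiv ℝ (fun y => Real.log ‖f y‖) x v = (fderiv ℝ f x v / f x).re := by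
  have hsq : (fun y => Real.log ‖f y‖) = fun y => (1 / 2) * Real.log (‖f y‖ ^ 2) := by
    funext y
    rw [Real.log_pow]
    push_cast
    ring
  have hnorm : ‖f x‖ ^ 2 ≠ 0 := pow_ne_zero 2 (norm_ne_zero_iff.2 h0)
  rw [hsq, ((hf.hasFDerivAt.norm_sq.log hnorm).const_mul (1 / 2)).fderiv]
  simp only [smul_apply, ContinuousLinearMap.comp_apply, coe_innerSL_apply, Complex.inner, mul_re,
    conj_re, conj_im, smul_eq_mul, nsmul_eq_mul, Nat.cast_ofNat, mul_neg,
    sub_neg_eq_add, div_re, normSq_eq_norm_sq]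
  field_simp

end LogNorm

section ExpPoint

variable {d : ℕ}

/-- The real-linear identification `(μ, θ) ↦ μ + iθ` of `ℝ^d × ℝ^d` with `ℂ^d`, the logarithmic
coordinates in which `expPoint` becomes the coordinatewise exponential. -/
noncomputable def logPoint (d : ℕ) : ((Fin d → ℝ) × (Fin d → ℝ)) →L[ℝ] (Fin d → ℂ) :=
  .pi fun i => ofRealCLM ∘L .proj i ∘L .fst ℝ _ _ + I • (ofRealCLM ∘L .proj i ∘L .snd ℝ _ _)

theorem expPoint_eq_exp_logPoint (μ θ : Fin d → ℝ) :
    expPoint μ θ = fun i => exp (logPoint d (μ, θ) i) := by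
  funext i
  simp [expPoint, logPoint, mul_comm]

theorem logPoint_snd_eq_I_smul_logPoint_fst (v : Fin d → ℝ) :
    logPoint d (0, v) = I • logPoint d (v, 0) := by
  funext i
  simp [logPoint]

theorem cauchyRiemann_comp_logPoint {G : (Fin d → ℂ) → ℂ} {q : (Fin d → ℝ) × (Fin d → ℝ)}
    (hG : DifferentiableAt ℂ G (logPoint d q)) (v : Fin d → ℝ) :
    fderiv ℝ (G ∘ logPoint d) q (0, v) = I * fderiv ℝ (G ∘ logPoint d) q (v, 0) := by
  have hderiv := (hG.hasFDerivAt.restrictScalars ℝ).comp q (logPoint d).hasFDerivAt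
  rw [hderiv.fderiv]
  simp [logPoint_snd_eq_I_smul_logPoint_fst]

theorem expPoint_update_two_pi (μ θ : Fin d → ℝ) (j : Fin d) :
    expPoint μ (Function.update θ j (2 * Real.pi)) = expPoint μ (Function.update θ j 0) := by
  funext i
  obtain rfl | hij := eq_or_ne i j
  · simp [expPoint, exp_add]
  · simp [expPoint, hij]

end ExpPoint

section Bloch

variable {d N : ℕ} {H : (Fin d → ℂ) → Matrix (Fin N) (Fin N) ℂ}

theorem mem_amoeba_iff_exists_circle {E : ℂ} {μ : Fin d → ℝ} :
    μ ∈ amoeba H E ↔ ∃ u : Fin d → Circle, charDet H E (fun i => exp (μ i) * u i) = 0 := by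
  have hexp : ∀ θ : Fin d → ℝ, expPoint μ θ = fun i => exp (μ i) * (Circle.exp (θ i) : ℂ) :=
    fun θ => funext fun i => by rw [expPoint, exp_add, Circle.coe_exp]
  refine ⟨fun ⟨θ, hθ⟩ => ⟨fun i => Circle.exp (θ i), hexp θ ▸ hθ⟩, fun ⟨u, hu⟩ =>
    ⟨fun i => (u i : ℂ).arg, ?_⟩⟩
  simpa only [hexp, Circle.exp_arg] using hu

theorem mem_pbcSpectrum_iff_zero_mem_amoeba {E : ℂ} : E ∈ pbcSpectrum H ↔ 0 ∈ amoeba H E := by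
  simp only [mem_amoeba_iff_exists_circle, Pi.zero_apply, ofReal_zero, exp_zero, one_mul]
  exact ⟨fun ⟨z, hz, h⟩ => ⟨fun i => ⟨z i, mem_sphere_zero_iff_norm.2 (hz i)⟩, h⟩,
    fun ⟨u, h⟩ => ⟨fun i => u i, fun i => Circle.norm_coe _, h⟩⟩

theorem charDet_eq_zero_iff_mem_spectrum {E : ℂ} {z : Fin d → ℂ} :
    charDet H E z = 0 ↔ E ∈ spectrum ℂ (H z) := by
  rw [spectrum.mem_iff, Matrix.isUnit_iff_isUnit_det, isUnit_iff_ne_zero, not_not, charDet,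
    Algebra.algebraMap_eq_smul_one]

theorem pbcSpectrum_nonempty (hN : 0 < N) : (pbcSpectrum H).Nonempty := by
  have : Nonempty (Fin N) := ⟨⟨0, hN⟩⟩
  obtain ⟨E, hE⟩ := spectrum.nonempty_of_isAlgClosed_of_finiteDimensional ℂ (H fun _ => 1)
  exact ⟨E, fun _ => 1, by simp, charDet_eq_zero_iff_mem_spectrum.2 hE⟩

namespace IsBlochHamiltonian

theorem isClosed_setOf_mem_amoeba (hH : IsBlochHamiltonian H) :
    IsClosed {q : ℂ × (Fin d → ℝ) | q.2 ∈ amoeba H q.1} := by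
  have hentry : ∀ a b, Continuous fun q : (ℂ × (Fin d → ℝ)) × (Fin d → Circle) =>
      H (fun i => exp (q.1.2 i) * q.2 i) a b := fun a b =>
    (hH a b).continuousOn.comp_continuous (by fun_prop)
      fun q i => mul_ne_zero (exp_ne_zero _) (Circle.coe_ne_zero _)
  have hdet : Continuous fun q : (ℂ × (Fin d → ℝ)) × (Fin d → Circle) =>
      charDet H q.1.1 (fun i => exp (q.1.2 i) * q.2 i) :=
    (((continuous_fst.comp continuous_fst).smul continuous_const).sub
      (continuous_matrix hentry)).matrix_det
  convert isClosedMap_fst_of_compactSpace _ (isClosed_singleton.preimage hdet (t := {0})) using 1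
  ext q
  simp [mem_amoeba_iff_exists_circle]

theorem isOpen_compl_amoeba (hH : IsBlochHamiltonian H) (E : ℂ) : IsOpen (amoeba H E)ᶜ :=
  (hH.isClosed_setOf_mem_amoeba.preimage (Continuous.prodMk_right E)).isOpen_compl

theorem isClosed_pbcSpectrum (hH : IsBlochHamiltonian H) : IsClosed (pbcSpectrum H) := by
  convert hH.isClosed_setOf_mem_amoeba.preimage (Continuous.prodMk_left 0) using 1
  ext E
  exact mem_pbcSpectrum_iff_zero_mem_amoeba

attribute [local instance] Matrix.linftyOpNormedRing Matrix.linftyOpNormedAlgebra in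
theorem exists_norm_le_of_mem_pbcSpectrum_smul (hH : IsBlochHamiltonian H) :
    ∃ C : ℝ, ∀ b : ℂ, ‖b‖ ≤ 1 → ∀ E ∈ pbcSpectrum (b • H), ‖E‖ ≤ C := by
  have htorus : IsCompact {z : Fin d → ℂ | ∀ i, ‖z i‖ = 1} := by
    simpa [pi, mem_sphere_zero_iff_norm] using
      isCompact_univ_pi fun _ : Fin d => isCompact_sphere (0 : ℂ) 1
  have hcont : ContinuousOn H {z | ∀ i, ‖z i‖ = 1} := by
    refine continuousOn_pi.2 fun a => continuousOn_pi.2 fun b => (hH a b).continuousOn.mono ?_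
    exact fun z hz i => norm_ne_zero_iff.1 (by simp [hz i])
  obtain ⟨C, hC⟩ := htorus.exists_bound_of_continuousOn hcont
  refine ⟨C * ‖(1 : Matrix (Fin N) (Fin N) ℂ)‖, fun b hb E ⟨z, hz, hE⟩ => ?_⟩
  calc ‖E‖ ≤ ‖b • H z‖ * ‖(1 : Matrix (Fin N) (Fin N) ℂ)‖ :=
        spectrum.norm_le_norm_mul_of_mem (charDet_eq_zero_iff_mem_spectrum.1 hE)
    _ ≤ C * ‖(1 : Matrix (Fin N) (Fin N) ℂ)‖ := by
        gcongr
        rw [norm_smul]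
        exact (mul_le_of_le_one_left (norm_nonneg _) hb).trans (hC z hz)

theorem isCompact_pbcSpectrum (hH : IsBlochHamiltonian H) : IsCompact (pbcSpectrum H) := by
  obtain ⟨C, hC⟩ := hH.exists_norm_le_of_mem_pbcSpectrum_smul
  exact Metric.isCompact_of_isClosed_isBounded hH.isClosed_pbcSpectrum
    (isBounded_iff_forall_norm_le.2 ⟨C, by simpa using hC 1 (by simp)⟩)

theorem contDiff_charDet_smul_exp (hH : IsBlochHamiltonian H) :
    ContDiff ℂ 1 fun q : ℂ × ℂ × (Fin d → ℂ) =>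
      charDet (q.2.1 • H) q.1 fun i => exp (q.2.2 i) := by
  have hentry : ∀ a b, ContDiff ℂ 1 fun q : ℂ × ℂ × (Fin d → ℂ) =>
      H (fun i => exp (q.2.2 i)) a b := fun a b =>
    (hH a b).contDiffOn_of_completeSpace.comp_contDiff (by fun_prop) fun q i => exp_ne_zero _
  simp only [charDet, Matrix.det_apply, Matrix.sub_apply, Matrix.smul_apply, Pi.smul_apply,
    smul_eq_mul]
  refine ContDiff.sum fun σ _ => ContDiff.const_smul _ (contDiff_prod fun i _ => ?_)
  exact (contDiff_fst.mul contDiff_const).sub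
    ((contDiff_fst.comp contDiff_snd).mul (hentry _ _))

theorem contDiff_charDet_smul_expPoint (hH : IsBlochHamiltonian H) :
    ContDiff ℝ 1 fun q : (ℂ × ℂ × (Fin d → ℝ)) × (Fin d → ℝ) =>
      charDet (q.1.2.1 • H) q.1.1 (expPoint q.1.2.2 q.2) := by
  simp only [expPoint_eq_exp_logPoint]
  exact hH.contDiff_charDet_smul_exp.restrict_scalars ℝ |>.comp
    (f := fun q : (ℂ × ℂ × (Fin d → ℝ)) × (Fin d → ℝ) =>
      (q.1.1, q.1.2.1, logPoint d (q.1.2.2, q.2))) (by fun_prop)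

end IsBlochHamiltonian
end Bloch

section CharDetLoop

variable {d N : ℕ} {H : (Fin d → ℂ) → Matrix (Fin N) (Fin N) ℂ}

/-- The loop traced by `det (E - H(e^{μ + iθ}))` as the angle `θ_j` runs over `[0, 2π]`. -/
noncomputable def charDetLoop (H : (Fin d → ℂ) → Matrix (Fin N) (Fin N) ℂ) (E : ℂ)
    (μ θ : Fin d → ℝ) (j : Fin d) (t : ℝ) : ℂ :=
  charDet H E (expPoint μ (Function.update θ j t))

/-- The integrand `log |det (E - H(e^{μ + iθ}))|` of the Ronkin function, as a function on
`ℝ^d × ℝ^d` of the pair `(μ, θ)`. -/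
noncomputable def ronkinIntegrand (H : (Fin d → ℂ) → Matrix (Fin N) (Fin N) ℂ) (E : ℂ)
    (q : (Fin d → ℝ) × (Fin d → ℝ)) : ℝ :=
  Real.log ‖charDet H E (expPoint q.1 q.2)‖

theorem charDetLoop_update (E : ℂ) (μ θ : Fin d → ℝ) (j : Fin d) (s : ℝ) :
    charDetLoop H E μ (Function.update θ j s) j = charDetLoop H E μ θ j := by
  funext t
  simp only [charDetLoop, Function.update_idem]

theorem logIncrement_charDetLoop_zero_smul (E : ℂ) (μ θ : Fin d → ℝ) (j : Fin d) :
    logIncrement (charDetLoop ((0 : ℂ) • H) E μ θ j) = 0 := by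
  have hconst : charDetLoop ((0 : ℂ) • H) E μ θ j = fun _ => E ^ N := by
    funext t
    simp [charDetLoop, charDet]
  simp only [logIncrement, hconst, logDeriv_const, Pi.zero_apply, intervalIntegral.integral_zero]

namespace IsBlochHamiltonian

theorem logIncrement_charDetLoop_eq_of_isPreconnected (hH : IsBlochHamiltonian H)
    {S : Set (ℂ × ℂ × (Fin d → ℝ))} (hS : IsPreconnected S)
    (hamoeba : ∀ q ∈ S, q.2.2 ∉ amoeba (q.2.1 • H) q.1) (θ : Fin d → ℝ) (j : Fin d)
    {E₁ b₁ E₂ b₂ : ℂ} {μ₁ μ₂ : Fin d → ℝ} (h₁ : (E₁, b₁, μ₁) ∈ S) (h₂ : (E₂, b₂, μ₂) ∈ S) :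
    logIncrement (charDetLoop (b₁ • H) E₁ μ₁ θ j) =
      logIncrement (charDetLoop (b₂ • H) E₂ μ₂ θ j) :=
  logIncrement_update_eq_of_isPreconnected
    (F := fun q : (ℂ × ℂ × (Fin d → ℝ)) × (Fin d → ℝ) =>
      charDet (q.1.2.1 • H) q.1.1 (expPoint q.1.2.2 q.2))
    (v := (E₁, b₁, μ₁)) (w := (E₂, b₂, μ₂)) hH.contDiff_charDet_smul_expPoint θ j hS
    (fun q hq _ h => hamoeba q hq ⟨_, h⟩)
    (fun q _ => congrArg (charDet (q.2.1 • H) q.1) (expPoint_update_two_pi q.2.2 θ j)) h₁ h₂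

theorem logIncrement_charDetLoop_eq_of_subset_compl_amoeba (hH : IsBlochHamiltonian H) {E : ℂ}
    {U : Set (Fin d → ℝ)} (hU : IsPreconnected U) (hUamoeba : U ⊆ (amoeba H E)ᶜ)
    (θ : Fin d → ℝ) (j : Fin d) {μ₁ μ₂ : Fin d → ℝ} (h₁ : μ₁ ∈ U) (h₂ : μ₂ ∈ U) :
    logIncrement (charDetLoop H E μ₁ θ j) = logIncrement (charDetLoop H E μ₂ θ j) := by
  simpa only [one_smul] using hH.logIncrement_charDetLoop_eq_of_isPreconnected
    (hU.image (fun μ => (E, (1 : ℂ), μ)) (by fun_prop))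
    (by rintro _ ⟨μ, hμ, rfl⟩; simpa using hUamoeba hμ) θ j
    (mem_image_of_mem _ h₁) (mem_image_of_mem _ h₂)

theorem logIncrement_charDetLoop_zero_eq_of_disjoint_pbcSpectrum (hH : IsBlochHamiltonian H)
    {S : Set ℂ} (hS : IsPreconnected S) (hdisj : Disjoint S (pbcSpectrum H)) (θ : Fin d → ℝ)
    (j : Fin d) {E₁ E₂ : ℂ} (h₁ : E₁ ∈ S) (h₂ : E₂ ∈ S) :
    logIncrement (charDetLoop H E₁ 0 θ j) = logIncrement (charDetLoop H E₂ 0 θ j) := by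
  simpa only [one_smul] using hH.logIncrement_charDetLoop_eq_of_isPreconnected
    (hS.image (fun E => (E, (1 : ℂ), 0)) (by fun_prop))
    (by
      rintro _ ⟨E, hE, rfl⟩
      simpa [← mem_pbcSpectrum_iff_zero_mem_amoeba] using hdisj.notMem_of_mem_left hE) θ j
    (mem_image_of_mem _ h₁) (mem_image_of_mem _ h₂)

/-- Switching off the hopping, `b • H` with `b` going from `1` to `0`, makes the loop constant. -/
theorem logIncrement_charDetLoop_zero_eq_zero_of_forall_smul (hH : IsBlochHamiltonian H) {E : ℂ}
    (hE : ∀ b : ℂ, ‖b‖ ≤ 1 → E ∉ pbcSpectrum (b • H)) (θ : Fin d → ℝ) (j : Fin d) :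
    logIncrement (charDetLoop H E 0 θ j) = 0 := by
  have hswitch := hH.logIncrement_charDetLoop_eq_of_isPreconnected
    ((convex_closedBall (0 : ℂ) 1).isPreconnected.image
      (fun b => (E, b, (0 : Fin d → ℝ))) (by fun_prop))
    (by
      rintro _ ⟨b, hb, rfl⟩
      exact mem_pbcSpectrum_iff_zero_mem_amoeba.not.1 (hE b (by simpa using hb))) θ j
    (mem_image_of_mem _ (by simp : (1 : ℂ) ∈ Metric.closedBall 0 1))
    (mem_image_of_mem _ (by simp : (0 : ℂ) ∈ Metric.closedBall 0 1))
  rwa [one_smul, logIncrement_charDetLoop_zero_smul] at hswitch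

theorem logIncrement_charDetLoop_zero_eq_zero (hH : IsBlochHamiltonian H) {S : Set ℂ}
    (hS : IsPreconnected S) (hunbounded : ¬Bornology.IsBounded S)
    (hdisj : Disjoint S (pbcSpectrum H)) {E : ℂ} (hE : E ∈ S) (θ : Fin d → ℝ) (j : Fin d) :
    logIncrement (charDetLoop H E 0 θ j) = 0 := by
  obtain ⟨C, hC⟩ := hH.exists_norm_le_of_mem_pbcSpectrum_smul
  obtain ⟨E₁, hE₁, hCE₁⟩ : ∃ E₁ ∈ S, C < ‖E₁‖ := by
    by_contra! hbound
    exact hunbounded (isBounded_iff_forall_norm_le.2 ⟨C, hbound⟩)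
  rw [hH.logIncrement_charDetLoop_zero_eq_of_disjoint_pbcSpectrum hS hdisj θ j hE hE₁]
  exact hH.logIncrement_charDetLoop_zero_eq_zero_of_forall_smul
    (fun b hb hspec => (hC b hb E₁ hspec).not_gt hCE₁) θ j

theorem contDiff_charDet_expPoint (hH : IsBlochHamiltonian H) (E : ℂ) :
    ContDiff ℝ 1 fun q : (Fin d → ℝ) × (Fin d → ℝ) => charDet H E (expPoint q.1 q.2) := by
  simpa only [Function.comp_def, one_smul] using hH.contDiff_charDet_smul_expPoint.comp
    (f := fun q : (Fin d → ℝ) × (Fin d → ℝ) => ((E, (1 : ℂ), q.1), q.2)) (by fun_prop)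

theorem contDiff_charDetLoop (hH : IsBlochHamiltonian H) (E : ℂ) (μ θ : Fin d → ℝ) (j : Fin d) :
    ContDiff ℝ 1 (charDetLoop H E μ θ j) :=
  (hH.contDiff_charDet_expPoint E).comp (contDiff_const.prodMk (contDiff_update 1 θ j))

theorem contDiffOn_ronkinIntegrand (hH : IsBlochHamiltonian H) (E : ℂ) :
    ContDiffOn ℝ 1 (ronkinIntegrand H E) ((amoeba H E)ᶜ ×ˢ univ) :=
  have hne : ∀ q ∈ (amoeba H E)ᶜ ×ˢ univ, charDet H E (expPoint q.1 q.2) ≠ 0 :=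
    fun _ hq h => hq.1 ⟨_, h⟩
  ((hH.contDiff_charDet_expPoint E).contDiffOn.norm ℂ hne).log
    fun q hq => norm_ne_zero_iff.2 (hne q hq)

theorem continuous_fderiv_ronkinIntegrand (hH : IsBlochHamiltonian H) {E : ℂ} {μ : Fin d → ℝ}
    (hμ : μ ∉ amoeba H E) : Continuous fun θ => fderiv ℝ (ronkinIntegrand H E) (μ, θ) :=
  ((hH.contDiffOn_ronkinIntegrand E).continuousOn_fderiv_of_isOpen
    ((hH.isOpen_compl_amoeba E).prod isOpen_univ) le_rfl).comp_continuous
      (Continuous.prodMk_right μ) fun _ => ⟨hμ, trivial⟩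

theorem differentiable_charDet_exp (hH : IsBlochHamiltonian H) (E : ℂ) :
    Differentiable ℂ fun w : Fin d → ℂ => charDet H E fun i => exp (w i) := by
  have hcomp := hH.contDiff_charDet_smul_exp.comp (f := fun w : Fin d → ℂ => (E, (1 : ℂ), w))
    (by fun_prop)
  simpa only [Function.comp_def, one_smul] using hcomp.differentiable one_ne_zero

theorem cauchyRiemann_charDet_expPoint (hH : IsBlochHamiltonian H) (E : ℂ)
    (q : (Fin d → ℝ) × (Fin d → ℝ)) (v : Fin d → ℝ) :
    fderiv ℝ (fun q : (Fin d → ℝ) × (Fin d → ℝ) => charDet H E (expPoint q.1 q.2)) q (0, v) =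
      I * fderiv ℝ (fun q : (Fin d → ℝ) × (Fin d → ℝ) => charDet H E (expPoint q.1 q.2)) q
        (v, 0) := by
  simp only [expPoint_eq_exp_logPoint]
  exact cauchyRiemann_comp_logPoint (hH.differentiable_charDet_exp E _) v

theorem deriv_charDetLoop (hH : IsBlochHamiltonian H) (E : ℂ) (μ θ : Fin d → ℝ) (j : Fin d) :
    deriv (charDetLoop H E μ θ j) (θ j) =
      fderiv ℝ (fun q : (Fin d → ℝ) × (Fin d → ℝ) => charDet H E (expPoint q.1 q.2)) (μ, θ)
        (0, Pi.single j 1) := by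
  have hupdate := (hasDerivAt_comp_update (v := μ) (θ := θ) (j := j) (t := θ j)
    ((hH.contDiff_charDet_expPoint E).differentiable one_ne_zero _)).deriv
  rwa [Function.update_eq_self] at hupdate

theorem fderiv_ronkinIntegrand_single (hH : IsBlochHamiltonian H) {E : ℂ} {μ : Fin d → ℝ}
    (hμ : μ ∉ amoeba H E) (θ : Fin d → ℝ) (j : Fin d) :
    fderiv ℝ (ronkinIntegrand H E) (μ, θ) (Pi.single j 1, 0) =
      (logDeriv (charDetLoop H E μ θ j) (θ j)).im := by
  have hmodulus := fderiv_log_norm_apply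
    ((hH.contDiff_charDet_expPoint E).differentiable one_ne_zero (μ, θ))
    (fun h => hμ ⟨θ, h⟩) (Pi.single j 1, 0)
  rw [logDeriv_apply, hH.deriv_charDetLoop, hH.cauchyRiemann_charDet_expPoint, mul_div_assoc,
    I_mul_im, charDetLoop, Function.update_eq_self]
  exact hmodulus

theorem setIntegral_fderiv_ronkinIntegrand_single_eq_zero (hH : IsBlochHamiltonian H) {E : ℂ}
    {μ : Fin d → ℝ} (hμ : μ ∉ amoeba H E) {j : Fin d}
    (hlog : ∀ θ, logIncrement (charDetLoop H E μ θ j) = 0) :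
    ∫ θ in Icc (0 : Fin d → ℝ) (fun _ => 2 * Real.pi),
      fderiv ℝ (ronkinIntegrand H E)
        (μ, θ) (Pi.single j 1, 0) = 0 := by
  refine setIntegral_Icc_eq_zero_of_setIntegral_update ?_ j fun θ => ?_
  · exact ((hH.continuous_fderiv_ronkinIntegrand hμ).clm_apply
      continuous_const).continuousOn.integrableOn_compact isCompact_Icc
  · have hintegrable :
        IntervalIntegrable (logDeriv (charDetLoop H E μ θ j)) volume 0 (2 * Real.pi) :=
      (continuous_logDeriv (hH.contDiff_charDetLoop E μ θ j)
        fun t h => hμ ⟨_, h⟩).intervalIntegrable _ _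
    calc _ = ∫ t in Icc 0 (2 * Real.pi), (logDeriv (charDetLoop H E μ θ j) t).im := by
          simp only [hH.fderiv_ronkinIntegrand_single hμ, charDetLoop_update,
            Function.update_self, Pi.zero_apply]
      _ = (logIncrement (charDetLoop H E μ θ j)).im := by
          rw [integral_Icc_eq_integral_Ioc, ← intervalIntegral.integral_of_le (by positivity)]
          exact imCLM.intervalIntegral_comp_comm hintegrable
      _ = 0 := by rw [hlog, zero_im]

theorem hasFDerivAt_ronkin_zero (hH : IsBlochHamiltonian H) {E : ℂ} {μ : Fin d → ℝ}
    (hμ : μ ∉ amoeba H E) (hlog : ∀ θ j, logIncrement (charDetLoop H E μ θ j) = 0) :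
    HasFDerivAt (ronkin H E) (0 : (Fin d → ℝ) →L[ℝ] ℝ) μ := by
  let L : (Fin d → ℝ) → (Fin d → ℝ) →L[ℝ] ℝ := fun θ =>
    (fderiv ℝ (ronkinIntegrand H E) (μ, θ)).comp (.inl ℝ (Fin d → ℝ) (Fin d → ℝ))
  let K := Icc (0 : Fin d → ℝ) fun _ => 2 * Real.pi
  have hintegrable : IntegrableOn L K :=
    ((hH.continuous_fderiv_ronkinIntegrand hμ).clm_comp
      continuous_const).continuousOn.integrableOn_compact isCompact_Icc
  have hzero : ∫ θ in K, L θ = 0 := by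
    refine ContinuousLinearMap.coe_injective (LinearMap.pi_ext' fun j => LinearMap.ext_ring ?_)
    calc (∫ θ in K, L θ) (Pi.single j 1) = ∫ θ in K, L θ (Pi.single j 1) :=
          ContinuousLinearMap.integral_apply hintegrable _
      _ = 0 := hH.setIntegral_fderiv_ronkinIntegrand_single_eq_zero hμ fun θ => hlog θ j
  have hderiv := hasFDerivAt_setIntegral_of_contDiffOn (hH.isOpen_compl_amoeba E)
    (hH.contDiffOn_ronkinIntegrand E) (isCompact_Icc : IsCompact K) volume hμ
  have hronkin := hderiv.const_mul (((2 * Real.pi) ^ d)⁻¹)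
  rwa [hzero, smul_zero] at hronkin

theorem isCentralHole_connectedComponentIn (hH : IsBlochHamiltonian H) {E : ℂ} {μ : Fin d → ℝ}
    (hμ : μ ∉ amoeba H E) (hlog : ∀ θ j, logIncrement (charDetLoop H E μ θ j) = 0) :
    IsCentralHole H E (connectedComponentIn (amoeba H E)ᶜ μ) := by
  have hderiv : ∀ x ∈ connectedComponentIn (amoeba H E)ᶜ μ,
      HasFDerivAt (ronkin H E) (0 : (Fin d → ℝ) →L[ℝ] ℝ) x := fun x hx =>
    hH.hasFDerivAt_ronkin_zero (connectedComponentIn_subset _ _ hx) fun θ j =>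
      (hH.logIncrement_charDetLoop_eq_of_subset_compl_amoeba isPreconnected_connectedComponentIn
        (connectedComponentIn_subset _ _) θ j hx (mem_connectedComponentIn hμ)).trans (hlog θ j)
  exact ⟨⟨μ, hμ, rfl⟩, fun _ h₁ _ h₂ =>
    (hH.isOpen_compl_amoeba E).connectedComponentIn.is_const_of_fderiv_eq_zero
      isPreconnected_connectedComponentIn
      (fun x hx => (hderiv x hx).differentiableAt.differentiableWithinAt)
      (fun x hx => (hderiv x hx).fderiv) h₁ h₂⟩

theorem exists_isGreatest_im_pbcSpectrum (hH : IsBlochHamiltonian H) (hN : 0 < N) :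
    ∃ M : ℝ, IsGreatest (im '' pbcSpectrum H) M :=
  (hH.isCompact_pbcSpectrum.image continuous_im).exists_isGreatest
    ((pbcSpectrum_nonempty hN).image im)

end IsBlochHamiltonian
end CharDetLoop

theorem not_isBounded_setOf_lt_im (M : ℝ) : ¬Bornology.IsBounded {z : ℂ | M < z.im} := by
  intro hbounded
  obtain ⟨C, hC⟩ := isBounded_iff_forall_norm_le.1 hbounded
  have hnorm := hC ((max M C + 1 : ℝ) * I) (by
    simpa using (le_max_left M C).trans_lt (lt_add_one _))
  have him := (le_abs_self _).trans ((abs_im_le_norm _).trans hnorm)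
  simp only [im_ofReal_mul, I_im, mul_one] at him
  linarith [le_max_right M C]

theorem mainTheorem8_general {d N : ℕ} {H : (Fin d → ℂ) → Matrix (Fin N) (Fin N) ℂ}
    (hH : IsBlochHamiltonian H) {S : Set ℂ} (hS : IsPreconnected S)
    (hunbounded : ¬Bornology.IsBounded S) (hdisj : Disjoint S (pbcSpectrum H)) {E : ℂ}
    (hE : E ∈ S) :
    (∃ U : Set (Fin d → ℝ), IsCentralHole H E U ∧ (0 : Fin d → ℝ) ∈ U) ∧
      HasFDerivAt (ronkin H E) (0 : (Fin d → ℝ) →L[ℝ] ℝ) 0 ∧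
      ∀ (j : Fin d) (θ : Fin d → ℝ),
        HasWindingNumber (fun t : ℝ => charDet H E (expPoint 0 (Function.update θ j t))) 0 := by
  have hzero : (0 : Fin d → ℝ) ∉ amoeba H E :=
    mem_pbcSpectrum_iff_zero_mem_amoeba.not.1 (hdisj.notMem_of_mem_left hE)
  have hlog := hH.logIncrement_charDetLoop_zero_eq_zero hS hunbounded hdisj hE
  exact ⟨⟨_, hH.isCentralHole_connectedComponentIn hzero hlog, mem_connectedComponentIn hzero⟩,
    hH.hasFDerivAt_ronkin_zero hzero hlog, fun j θ =>
      hasWindingNumber_of_logIncrement_eq (hH.contDiff_charDetLoop E 0 θ j)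
        (fun _ h => hzero ⟨_, h⟩) (by simpa using hlog θ j)⟩

theorem mainTheorem8 {d N : ℕ} (hN : 0 < N)
    (H : (Fin d → ℂ) → Matrix (Fin N) (Fin N) ℂ) (hH : IsBlochHamiltonian H) :
    ∃ M : ℝ, IsGreatest (Complex.im '' pbcSpectrum H) M ∧
      ∀ E : ℂ, M < E.im →
        (∃ U : Set (Fin d → ℝ), IsCentralHole H E U ∧ (0 : Fin d → ℝ) ∈ U) ∧
        HasFDerivAt (ronkin H E) (0 : (Fin d → ℝ) →L[ℝ] ℝ) 0 ∧
        ∀ (j : Fin d) (θ : Fin d → ℝ),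
          HasWindingNumber
            (fun t : ℝ => charDet H E (expPoint 0 (Function.update θ j t))) 0 := by
  obtain ⟨M, hM⟩ := hH.exists_isGreatest_im_pbcSpectrum hN
  have hdisj : Disjoint {z : ℂ | M < z.im} (pbcSpectrum H) :=
    disjoint_left.2 fun _ hz hspec => hz.not_ge (hM.2 (mem_image_of_mem im hspec))
  exact ⟨M, hM, fun E hE => mainTheorem8_general hH (convex_halfSpace_im_gt M).isPreconnected
    (not_isBounded_setOf_lt_im M) hdisj hE⟩
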